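/- For complex $a,q$ with $|q|<1$ and $n\ge 0$ put $(a;q)_n=\prod_{j=0}^{n-1}(1-aq^j)$, $(a;q)_\infty=\prod_{j=0}^{\infty}(1-aq^j)$ and $(a,b,c;q)_\infty=(a;q)_\infty(b;q)_\infty(c;q)_\infty$. Let $|q|<1$; in parts (2) and (3), $q^{1/2}$ denotes any fixed complex number $s$ with $s^2=q$, and $q^{r/2}=s^r$ for integers $r\ge 0$. All the multiple series below converge absolutely. (1) The following four identities hold: \begin{align*} \sum_{i,j,k\ge 0}\frac{q^{i^2+2j^2+4k^2+2ik+4jk}}{(q^2;q^2)_i(q^2;q^2)_j(q^4;q^4)_k}&=\frac{(q^5,q^6,q^{11};q^{11})_\infty}{(q;q^2)_\infty(q^4;q^4)_\infty},\\ \sum_{i,j,k\ge 0}\frac{q^{i^2+2j^2+4k^2+2ik+4jk+2k}}{(q^2;q^2)_i(q^2;q^2)_j(q^4;q^4)_k}&=\frac{(q^4,q^7,q^{11};q^{11})_\infty}{(q;q^2)_\infty(q^4;q^4)_\infty},\\ \sum_{i,j,k\ge 0}\frac{q^{i^2+2j^2+4k^2+2ik+4jk+2j+4k}}{(q^2;q^2)_i(q^2;q^2)_j(q^4;q^4)_k}&=\frac{(q^2,q^9,q^{11};q^{11})_\infty}{(q;q^2)_\infty(q^4;q^4)_\infty},\\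 \sum_{i,j,k\ge 0}\frac{q^{i^2+2j^2+4k^2+2ik+4jk+2i+2j+4k}}{(q^2;q^2)_i(q^2;q^2)_j(q^4;q^4)_k}&=\frac{(q,q^{10},q^{11};q^{11})_\infty}{(q;q^2)_\infty(q^4;q^4)_\infty}. \end{align*} For $k\ge 1$ and $n_1,\dots,n_k\ge 0$ write $N_j=n_j+n_{j+1}+\cdots+n_k$ for $1\le j\le k$; the sum $N_i+\cdots+N_k$ is $0$ when $i=k+1$. (2) For all integers $k\ge 1$ and $1\le i\le k+1$, $$\sum_{m,n_1,\dots,n_k\ge 0}\frac{q^{\frac12 m^2+mn_k+N_1^2+\cdots+N_k^2+N_i+N_{i+1}+\cdots+N_k}}{(q;q)_m(q;q)_{n_1}\cdots(q;q)_{n_{k-1}}(q^2;q^2)_{n_k}}=\frac{(-q^{\frac12};q)_\infty\,(q^{i},q^{\frac32+2k-i},q^{\frac32+2k};q^{\frac32+2k})_\infty}{(q;q)_\infty}.$$ (3) For all integers $k\ge 1$, $$\sum_{m,n_1,\dots,n_k\ge 0}\frac{q^{\frac12 m^2+mn_k+N_1^2+\cdots+N_k^2+m+N_1+\cdots+N_k}}{(q;q)_m(q;q)_{n_1}\cdots(q;q)_{n_{k-1}}(q^2;q^2)_{n_k}}=\frac{(-q^{\frac12};q)_\infty\,(q^{\frac12},q^{1+2k},q^{\frac32+2k};q^{\frac32+2k})_\infty}{(q;q)_\infty}.$$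 -/

import Mathlib

/-- The finite `q`-shifted factorial `(a; q)_n = ∏_{j=0}^{n-1} (1 - a q^j)`. -/
noncomputable def qPoch (a q : ℂ) (n : ℕ) : ℂ :=
  ∏ j ∈ Finset.range n, (1 - a * q ^ j)

/-- The infinite `q`-shifted factorial `(a; q)_∞ = ∏_{j≥0} (1 - a q^j)`, meant for `‖q‖ < 1`. -/
noncomputable def qPochInf (a q : ℂ) : ℂ :=
  ∏' j : ℕ, (1 - a * q ^ j)

/-- `(a, b, c; q)_∞ = (a; q)_∞ (b; q)_∞ (c; q)_∞`. -/
noncomputable def qPochInf₃ (a b c q : ℂ) : ℂ :=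
  qPochInf a q * qPochInf b q * qPochInf c q

/-- For `‖q‖ < 1` the infinite product defining `(a; q)_∞` converges, so `qPochInf` is its value. -/
theorem hasProd_qPochInf (a q : ℂ) (hq : ‖q‖ < 1) :
    HasProd (fun j : ℕ => 1 - a * q ^ j) (qPochInf a q) := by
  have h : Multipliable (fun j : ℕ => 1 + -(a * q ^ j)) := by
    apply multipliable_one_add_of_summable
    simp only [norm_neg, norm_mul, norm_pow]
    exact (summable_geometric_of_lt_one (norm_nonneg q) hq).mul_left _
  simpa only [← sub_eq_add_neg, qPochInf] using h.hasProd

/-- The entry `n_j` (`1 ≤ j ≤ k`) of the tuple `n = (n_1, …, n_k)`, which is indexed by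
`Fin k = {0, …, k-1}`; it is `0` for all other `j`. -/
def nahmEntry {k : ℕ} (n : Fin k → ℕ) (j : ℕ) : ℕ :=
  if h : 1 ≤ j ∧ j ≤ k then n ⟨j - 1, by omega⟩ else 0

/-- `N_j = n_j + n_{j+1} + ⋯ + n_k`; this is `0` for `j > k`. -/
def nahmN {k : ℕ} (n : Fin k → ℕ) (j : ℕ) : ℕ :=
  ∑ l ∈ Finset.Icc j k, nahmEntry n l

/-- The product `(q; q)_m (q; q)_{n_1} ⋯ (q; q)_{n_{k-1}} (q²; q²)_{n_k}`, for `k ≥ 1`. -/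
noncomputable def nahmDenom (q : ℂ) {k : ℕ} (m : ℕ) (n : Fin k → ℕ) : ℂ :=
  qPoch q q m * (∏ j ∈ Finset.Icc 1 (k - 1), qPoch q q (nahmEntry n j)) *
    qPoch (q ^ 2) (q ^ 2) (nahmEntry n k)

/-- The product `(q²; q²)_i (q²; q²)_j (q⁴; q⁴)_k`. -/
noncomputable def tripleDenom (q : ℂ) (i j k : ℕ) : ℂ :=
  qPoch (q ^ 2) (q ^ 2) i * qPoch (q ^ 2) (q ^ 2) j * qPoch (q ^ 4) (q ^ 4) k

/-!
The sum over `m` is evaluated by Euler's identity; it turns the remaining sum over `n_1, …, n_k`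
into an iterated Bailey chain started at `β_n = 1 / ((q²; q²)_n (-s; q)_{n+d})`. Grouping by `N_1`
shows that, up to a factor `(q; q)_∞`, its value is the limit of the last `β`-sequence of the chain.

Here the `α`-side of a Bailey pair is replaced by a bilateral sequence `c` on `ℤ`, with
`β_n = ∑_r c_r / ((q; q)_{n-r} (q; q)_{n+r+e})`, where `e = 0, 1` stand for `a = 1, q`. By the
`q`-Chu-Vandermonde convolution, a step of the chain multiplies `c_r` by `q^{r² + er}`, so theta
sequences `c_r = (-z)^r p^{r(r-1)/2}` stay theta sequences. The seeds arise from the base `p = s³`: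
the recurrences between `e = 0` and `e = 1`, combined with the reflection `z ↦ p / z`, then close
into a first order recurrence for `β`. When `p = q z`, a relation kept by the steps relative to
`a = q`, the sums with `e = 0` and `e = 1` agree, because the sum with `e = 1` vanishes at `z = p`;
this allows the switch from `a = q` to `a = 1`. As `n → ∞` the last `β`-sequence tends to a theta
series, which the Jacobi triple product evaluates.
-/

open Finset Filter Topology

theorem not_isOfFinOrder_of_norm_lt_one {𝕜 : Type*} [NormedDivisionRing 𝕜] {q : 𝕜} (hq : ‖q‖ < 1) :
    ¬IsOfFinOrder q :=
  fun h => hq.ne h.norm_eq_one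

theorem norm_pow_lt_one_iff {𝕜 : Type*} [NormedDivisionRing 𝕜] {q : 𝕜} {n : ℕ} (hn : n ≠ 0) :
    ‖q ^ n‖ < 1 ↔ ‖q‖ < 1 := by
  rw [norm_pow, pow_lt_one_iff_of_nonneg (norm_nonneg q) hn]

theorem one_sub_pow_succ_ne_zero {R : Type*} [Ring R] {q : R} (hq : ¬IsOfFinOrder q) (n : ℕ) :
    1 - q ^ (n + 1) ≠ 0 :=
  fun h => hq <| isOfFinOrder_iff_pow_eq_one.mpr ⟨n + 1, n.succ_pos, (sub_eq_zero.mp h).symm⟩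

theorem qPoch_zero (a q : ℂ) : qPoch a q 0 = 1 :=
  prod_range_zero _

theorem qPoch_succ (a q : ℂ) (n : ℕ) : qPoch a q (n + 1) = qPoch a q n * (1 - a * q ^ n) :=
  prod_range_succ _ n

theorem qPoch_zero_left (q : ℂ) (n : ℕ) : qPoch 0 q n = 1 := by
  simp [qPoch]

theorem qPoch_add (a q : ℂ) (m n : ℕ) :
    qPoch a q (m + n) = qPoch a q m * qPoch (a * q ^ m) q n := by
  simp only [qPoch, prod_range_add, pow_add, mul_assoc]

theorem qPoch_self_succ (q : ℂ) (n : ℕ) :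
    qPoch q q (n + 1) = qPoch q q n * (1 - q ^ (n + 1)) := by
  rw [qPoch_succ, pow_succ']

theorem qPoch_self_ne_zero {q : ℂ} (hq : ¬IsOfFinOrder q) (n : ℕ) : qPoch q q n ≠ 0 :=
  prod_ne_zero_iff.mpr fun j _ => pow_succ' q j ▸ one_sub_pow_succ_ne_zero hq j

/-- The reciprocal `1 / (q; q)_m` for an integer `m`, equal to `0` when `m < 0`. This convention
lets the sums below range over all integers. -/
noncomputable def invPoch (q : ℂ) : ℤ → ℂ
  | .ofNat n => (qPoch q q n)⁻¹
  | .negSucc _ => 0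

theorem invPoch_natCast (q : ℂ) (n : ℕ) : invPoch q n = (qPoch q q n)⁻¹ :=
  rfl

theorem invPoch_of_neg (q : ℂ) {m : ℤ} (hm : m < 0) : invPoch q m = 0 := by
  obtain ⟨n, rfl⟩ := Int.eq_negSucc_of_lt_zero hm
  rfl

theorem invPoch_zero (q : ℂ) : invPoch q 0 = 1 := by
  simpa [qPoch_zero] using invPoch_natCast q 0

theorem one_sub_zpow_mul_invPoch {q : ℂ} (hq : ¬IsOfFinOrder q) (m : ℤ) :
    (1 - q ^ m) * invPoch q m = invPoch q (m - 1) := by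
  rcases lt_or_ge m 1 with h | h
  · rw [invPoch_of_neg q (show m - 1 < 0 by lia)]
    rcases (show m ≤ 0 by lia).lt_or_eq with h | rfl
    · rw [invPoch_of_neg q h, mul_zero]
    · rw [zpow_zero, sub_self, zero_mul]
  · obtain ⟨n, rfl⟩ : ∃ n : ℕ, m = (n + 1 : ℕ) := ⟨(m - 1).toNat, by lia⟩
    have hn := one_sub_pow_succ_ne_zero hq n
    rw [Nat.cast_succ, add_sub_cancel_right, ← Nat.cast_succ, invPoch_natCast, invPoch_natCast,
      qPoch_self_succ, zpow_natCast]
    field_simp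

/-! ### The Bailey chain -/

/-- The bilateral Bailey transform `∑_r c_r / ((q; q)_{n-r} (q; q)_{n+r+e})` of `c : ℤ → ℂ`. For
`e = 0` and `e = 1` it is the second member of a Bailey pair relative to `a = 1` and `a = q`. -/
noncomputable def baileySum (q : ℂ) (e : ℕ) (c : ℤ → ℂ) (n : ℕ) : ℂ :=
  ∑' r : ℤ, c r * (invPoch q (n - r) * invPoch q (n + r + e))

theorem summable_baileySum (q : ℂ) (e : ℕ) (c : ℤ → ℂ) (n : ℕ) :
    Summable fun r : ℤ => c r * (invPoch q (n - r) * invPoch q (n + r + e)) := by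
  refine summable_of_ne_finset_zero (s := Icc (-(n + e : ℤ)) n) fun r hr => ?_
  rw [mem_Icc, not_and_or] at hr
  rcases hr with hr | hr
  · rw [invPoch_of_neg q (m := n + r + e) (by lia), mul_zero, mul_zero]
  · rw [invPoch_of_neg q (m := n - r) (by lia), zero_mul, mul_zero]

theorem baileySum_sub_mul (q : ℂ) (e : ℕ) (c d : ℤ → ℂ) (x : ℂ) (n : ℕ) :
    baileySum q e (fun r => c r - x * d r) n = baileySum q e c n - x * baileySum q e d n := by
  simp only [baileySum]
  rw [← tsum_mul_left, ← (summable_baileySum q e c n).tsum_sub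
    ((summable_baileySum q e d n).mul_left x)]
  simp only [sub_mul, mul_assoc]

theorem baileySum_const_mul (q : ℂ) (e : ℕ) (x : ℂ) (c : ℤ → ℂ) (n : ℕ) :
    baileySum q e (fun r => x * c r) n = x * baileySum q e c n := by
  simp only [baileySum, mul_assoc, tsum_mul_left]

theorem baileySum_reflect (q : ℂ) (e : ℕ) (c : ℤ → ℂ) (n : ℕ) :
    baileySum q e (fun r => c (-r - e)) n = baileySum q e c n := by
  rw [baileySum, baileySum, ← (Equiv.subLeft (-(e : ℤ))).tsum_eq]
  refine tsum_congr fun r => ?_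
  rw [Equiv.subLeft_apply]
  ring_nf

theorem baileySum_zero_index (q : ℂ) (c : ℤ → ℂ) : baileySum q 0 c 0 = c 0 := by
  rw [baileySum, tsum_eq_single 0 fun r hr => ?_]
  · simp [invPoch_zero]
  · rcases lt_or_gt_of_ne hr with h | h
    · rw [invPoch_of_neg q (m := (0 : ℕ) + r + (0 : ℕ)) (by lia), mul_zero, mul_zero]
    · rw [invPoch_of_neg q (m := (0 : ℕ) - r) (by lia), zero_mul, mul_zero]

theorem baileySum_zero_eq_baileySum_one {q : ℂ} (hq : ¬IsOfFinOrder q) (hq0 : q ≠ 0) (c : ℤ → ℂ)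
    (n : ℕ) :
    baileySum q 0 c n =
      baileySum q 1 c n - q ^ (n + 1) * baileySum q 1 (fun r => q ^ r * c r) n := by
  rw [← baileySum_sub_mul]
  refine tsum_congr fun r => ?_
  have hrec := one_sub_zpow_mul_invPoch hq (n + r + (1 : ℕ))
  have hpow : q ^ ((n : ℤ) + r + (1 : ℕ)) = q ^ (n + 1) * q ^ r := by
    rw [← zpow_natCast, ← zpow_add₀ hq0]
    push_cast
    ring_nf
  rw [show (n : ℤ) + r + (0 : ℕ) = n + r + (1 : ℕ) - 1 by simp, ← hrec, hpow]
  ring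

theorem baileySum_one_eq_baileySum_zero {q : ℂ} (hq : ¬IsOfFinOrder q) (hq0 : q ≠ 0) (c : ℤ → ℂ)
    (n : ℕ) :
    baileySum q 1 c n =
      baileySum q 0 c (n + 1) - q ^ (n + 1) * baileySum q 0 (fun r => q⁻¹ ^ r * c r) (n + 1) := by
  rw [← baileySum_sub_mul]
  refine tsum_congr fun r => ?_
  have hrec := one_sub_zpow_mul_invPoch hq ((n + 1 : ℕ) - r)
  have hpow : q ^ (((n + 1 : ℕ) : ℤ) - r) = q ^ (n + 1) * q⁻¹ ^ r := by
    rw [zpow_sub₀ hq0, zpow_natCast, inv_zpow, div_eq_mul_inv]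
  rw [show (n : ℤ) - r = (n + 1 : ℕ) - r - 1 by push_cast; ring, ← hrec, hpow,
    show (n : ℤ) + r + (1 : ℕ) = (n + 1 : ℕ) + r + (0 : ℕ) by push_cast; ring]
  ring

theorem zpow_mul_mul_invPoch_of_nonpos (q : ℂ) {x : ℤ} (hx : x ≤ 0) (y : ℤ) :
    q ^ (x * y) * invPoch q x = invPoch q x := by
  rcases hx.lt_or_eq with h | rfl
  · rw [invPoch_of_neg q h, mul_zero]
  · rw [zero_mul, zpow_zero, one_mul]

theorem one_sub_zpow_ne_zero {K : Type*} [DivisionRing K] {q : K} (hq : ¬IsOfFinOrder q) {m : ℤ}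
    (hm : 0 < m) :
    1 - q ^ m ≠ 0 := by
  obtain ⟨n, rfl⟩ : ∃ n : ℕ, m = (n + 1 : ℕ) := ⟨(m - 1).toNat, by lia⟩
  exact_mod_cast one_sub_pow_succ_ne_zero hq n

/-- The summand of the `q`-Chu-Vandermonde convolution `sum_vandermondeTerm`. -/
noncomputable def vandermondeTerm (q : ℂ) (x y : ℤ) (p : ℕ × ℕ) : ℂ :=
  q ^ ((p.2 + x) * (p.2 + y)) * invPoch q p.1 * (invPoch q (p.2 + x) * invPoch q (p.2 + y))

-- Splits `1 - q^{a+b} = (1 - q^a) + q^a (1 - q^b)` for `a = p.1` and `b = p.2 + x`.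
theorem one_sub_zpow_mul_vandermondeTerm {q : ℂ} (hq : ¬IsOfFinOrder q) (hq0 : q ≠ 0)
    (x y : ℤ) (p : ℕ × ℕ) :
    (1 - q ^ ((p.1 + p.2 : ℕ) + x)) * vandermondeTerm q x y p =
      q ^ ((p.2 + x) * (p.2 + y)) * invPoch q (p.1 - 1) *
          (invPoch q (p.2 + x) * invPoch q (p.2 + y)) +
        q ^ (p.1 + (p.2 + x) * (p.2 + y)) * invPoch q p.1 *
          (invPoch q (p.2 + x - 1) * invPoch q (p.2 + y)) := by
  rw [vandermondeTerm, ← one_sub_zpow_mul_invPoch hq p.1, ← one_sub_zpow_mul_invPoch hq (p.2 + x),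
    Nat.cast_add, add_assoc (p.1 : ℤ), zpow_add₀ hq0 p.1, zpow_add₀ hq0 p.1]
  ring

theorem one_sub_zpow_mul_sum_vandermondeTerm {q : ℂ} (hq : ¬IsOfFinOrder q) (hq0 : q ≠ 0)
    {x : ℤ} (hx : x ≤ 0) (y : ℤ) (N : ℕ) :
    (1 - q ^ (N + 1 + x)) * ∑ p ∈ antidiagonal (N + 1), vandermondeTerm q x y p =
      ∑ p ∈ antidiagonal N, vandermondeTerm q x y p +
        q ^ (N + 1 + y) * ∑ p ∈ antidiagonal N, vandermondeTerm q x (y + 1) p := by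
  rw [← Nat.cast_succ, mul_sum, sum_congr rfl fun p hp =>
      HasAntidiagonal.mem_antidiagonal.mp hp ▸ one_sub_zpow_mul_vandermondeTerm hq hq0 x y p,
    sum_add_distrib, Nat.sum_antidiagonal_succ, Nat.sum_antidiagonal_succ', mul_sum,
    invPoch_of_neg q (m := ((0 : ℕ) : ℤ) - 1) (by lia),
    invPoch_of_neg q (m := ((0 : ℕ) : ℤ) + x - 1) (by lia), mul_zero, zero_mul, zero_mul, zero_add,
    mul_zero, zero_add]
  congr 1 <;> refine sum_congr rfl fun p hp => ?_
  · rw [vandermondeTerm, Nat.cast_succ, add_sub_cancel_right]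
  · simp only [vandermondeTerm, ← mul_assoc, ← zpow_add₀ hq0]
    rw [← HasAntidiagonal.mem_antidiagonal.mp hp]
    push_cast
    ring_nf

theorem sum_vandermondeTerm {q : ℂ} (hq : ¬IsOfFinOrder q) (hq0 : q ≠ 0) {x : ℤ} (hx : x ≤ 0)
    (y : ℤ) (N : ℕ) :
    ∑ p ∈ antidiagonal N, vandermondeTerm q x y p =
      invPoch q (N + x) * invPoch q (N + y) := by
  induction N generalizing y with
  | zero =>
    simp only [Nat.antidiagonal_zero, sum_singleton, vandermondeTerm, Nat.cast_zero,
      zero_add, invPoch_zero, mul_one]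
    rw [← mul_assoc, zpow_mul_mul_invPoch_of_nonpos q hx]
  | succ N ih =>
    rcases le_or_gt ((N + 1 : ℕ) + x) 0 with h | h
    · rw [Nat.sum_antidiagonal_succ, sum_eq_zero fun p hp => ?_, add_zero,
        vandermondeTerm, Nat.cast_zero, invPoch_zero, mul_one, ← mul_assoc,
        zpow_mul_mul_invPoch_of_nonpos q h]
      rw [HasAntidiagonal.mem_antidiagonal] at hp
      rw [vandermondeTerm, invPoch_of_neg q (m := p.2 + x) (by lia), zero_mul, mul_zero]
    · refine mul_left_cancel₀ (one_sub_zpow_ne_zero hq h) ?_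
      have hrecx := one_sub_zpow_mul_invPoch hq ((N + 1 : ℕ) + x)
      have hrecy := one_sub_zpow_mul_invPoch hq ((N + 1 : ℕ) + y)
      rw [show ((N + 1 : ℕ) : ℤ) + x - 1 = N + x by push_cast; ring] at hrecx
      rw [show ((N + 1 : ℕ) : ℤ) + y - 1 = N + y by push_cast; ring] at hrecy
      rw [Nat.cast_succ] at *
      rw [one_sub_zpow_mul_sum_vandermondeTerm hq hq0 hx, ih, ih, ← mul_assoc, ← mul_assoc, hrecx,
        ← hrecy]
      ring_nf

/-- One step of the Bailey chain on the `β`-side of a Bailey pair; for `e = 0` and `e = 1` the pair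
is relative to `a = 1` and `a = q`. -/
noncomputable def baileyStep (q : ℂ) (e : ℕ) (b : ℕ → ℂ) (N : ℕ) : ℂ :=
  ∑ p ∈ antidiagonal N, q ^ (p.2 ^ 2 + e * p.2) * (qPoch q q p.1)⁻¹ * b p.2

theorem sum_baileyStep_kernel {q : ℂ} (hq : ¬IsOfFinOrder q) (hq0 : q ≠ 0) {e : ℕ} (he : e ≤ 1)
    (N : ℕ) (r : ℤ) :
    ∑ p ∈ antidiagonal N, q ^ (p.2 ^ 2 + e * p.2) * (qPoch q q p.1)⁻¹ *
        (invPoch q (p.2 - r) * invPoch q (p.2 + r + e)) =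
      q ^ (r ^ 2 + e * r) * (invPoch q (N - r) * invPoch q (N + r + e)) := by
  have hconv : ∑ p ∈ antidiagonal N, vandermondeTerm q (-r) (r + e) p =
      invPoch q (N - r) * invPoch q (N + r + e) := by
    rcases le_or_gt 0 r with hr | hr
    · rw [sum_vandermondeTerm hq hq0 (by lia)]
      ring_nf
    · simp only [vandermondeTerm, mul_comm (_ + -r : ℤ), mul_comm (invPoch q (_ + -r))]
      refine (sum_vandermondeTerm hq hq0 (by lia) (-r) N).trans ?_
      ring_nf
  rw [← hconv, mul_sum]
  refine sum_congr rfl fun p _ => ?_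
  simp only [vandermondeTerm, invPoch_natCast, ← mul_assoc, ← zpow_add₀ hq0, ← zpow_natCast]
  push_cast
  ring_nf

theorem baileyStep_baileySum {q : ℂ} (hq : ¬IsOfFinOrder q) (hq0 : q ≠ 0) {e : ℕ} (he : e ≤ 1)
    (c : ℤ → ℂ) :
    baileyStep q e (baileySum q e c) = baileySum q e fun r => q ^ (r ^ 2 + e * r) * c r := by
  funext N
  have hsum (p : ℕ × ℕ) := (summable_baileySum q e c p.2).mul_left
    (q ^ (p.2 ^ 2 + e * p.2) * (qPoch q q p.1)⁻¹)
  simp only [baileyStep, baileySum, ← tsum_mul_left]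
  rw [← Summable.tsum_finsetSum fun p _ => hsum p]
  refine tsum_congr fun r => ?_
  rw [mul_right_comm, ← sum_baileyStep_kernel hq hq0 he, sum_mul]
  exact sum_congr rfl fun p _ => by ring

/-- The `β`-sequence at the end of a Bailey chain of `k` steps starting from `b`; the parameters
`e 0, e 1, …` are listed from the last step to the first, so that `e j` accompanies `N_{j+1}`. -/
noncomputable def baileyChain (q : ℂ) (b : ℕ → ℂ) : ℕ → (ℕ → ℕ) → ℕ → ℂ
  | 0, _ => b
  | k + 1, e => baileyStep q (e 0) (baileyChain q b k fun j => e (j + 1))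

/-! ### Theta series -/

/-- The general term `(-1)^r z^r p^{r(r-1)/2}` of Jacobi's theta series. -/
noncomputable def thetaTerm (p z : ℂ) (r : ℤ) : ℂ :=
  (-z) ^ r * p ^ (r * (r - 1) / 2)

theorem thetaTerm_zero (p z : ℂ) : thetaTerm p z 0 = 1 := by
  simp [thetaTerm]

theorem zpow_mul_thetaTerm (p w z : ℂ) (r : ℤ) :
    w ^ r * thetaTerm p z r = thetaTerm p (w * z) r := by
  rw [thetaTerm, thetaTerm, ← mul_assoc, ← mul_zpow, mul_neg]

theorem add_one_mul_self_ediv_two (r : ℤ) : (r + 1) * r / 2 = r * (r - 1) / 2 + r := by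
  rw [← Int.add_mul_ediv_right _ _ two_ne_zero]
  ring_nf

theorem thetaTerm_neg {p : ℂ} (hp : p ≠ 0) (z : ℂ) (r : ℤ) :
    thetaTerm p z (-r) = thetaTerm p (p / z) r := by
  rw [thetaTerm, thetaTerm, show -r * (-r - 1) = (r + 1) * r by ring, add_one_mul_self_ediv_two,
    zpow_add₀ hp, ← inv_zpow', mul_left_comm, ← mul_zpow, mul_comm]
  ring_nf

theorem thetaTerm_add_one {p z : ℂ} (hp : p ≠ 0) (hz : z ≠ 0) (r : ℤ) :
    thetaTerm p z (r + 1) = -z * thetaTerm p (p * z) r := by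
  rw [← zpow_mul_thetaTerm, thetaTerm, thetaTerm, add_sub_cancel_right, add_one_mul_self_ediv_two,
    zpow_add₀ hp, zpow_add_one₀ (neg_ne_zero.mpr hz)]
  ring

theorem zpow_sq_add_mul_thetaTerm {q : ℂ} (hq0 : q ≠ 0) (p z : ℂ) (e : ℕ) (r : ℤ) :
    q ^ (r ^ 2 + e * r) * thetaTerm p z r = thetaTerm (p * q ^ 2) (z * q ^ (e + 1)) r := by
  have htri : r ^ 2 + e * r = (e + 1 : ℕ) * r + 2 * (r * (r - 1) / 2) := by
    rw [Int.mul_ediv_cancel' (Int.even_mul_pred_self r).two_dvd]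
    push_cast
    ring
  rw [htri, zpow_add₀ hq0, zpow_mul, zpow_mul, zpow_natCast, zpow_ofNat, mul_comm z,
    ← zpow_mul_thetaTerm, thetaTerm, thetaTerm, mul_zpow p]
  ring

section ThetaSums

variable {p q z : ℂ}

theorem baileySum_zero_thetaTerm_div (hp : p ≠ 0) (q z : ℂ) :
    baileySum q 0 (thetaTerm p (p / z)) = baileySum q 0 (thetaTerm p z) := by
  funext n
  rw [← baileySum_reflect q 0 (thetaTerm p z)]
  simp only [Nat.cast_zero, sub_zero, thetaTerm_neg hp]

theorem baileySum_one_thetaTerm_div (hp : p ≠ 0) (hz : z ≠ 0) (q : ℂ) (n : ℕ) :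
    baileySum q 1 (thetaTerm p (p / z)) n = -z * baileySum q 1 (thetaTerm p (p * z)) n := by
  rw [← baileySum_reflect, ← baileySum_const_mul]
  refine congrArg (baileySum q 1 · n) (funext fun r => ?_)
  rw [← neg_add', thetaTerm_neg hp, div_div_cancel₀ hp, Nat.cast_one, thetaTerm_add_one hp hz]

theorem baileySum_one_thetaTerm_self (hp : p ≠ 0) (q : ℂ) (n : ℕ) :
    baileySum q 1 (thetaTerm p p) n = 0 := by
  have hrefl := baileySum_one_thetaTerm_div hp one_ne_zero q n
  rw [div_one, mul_one] at hrefl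
  linear_combination hrefl / 2

variable (hq : ¬IsOfFinOrder q) (hq0 : q ≠ 0)

include hq hq0

theorem baileySum_zero_thetaTerm_eq_sub (p z : ℂ) (n : ℕ) :
    baileySum q 0 (thetaTerm p z) n =
      baileySum q 1 (thetaTerm p z) n - q ^ (n + 1) * baileySum q 1 (thetaTerm p (q * z)) n := by
  simpa only [zpow_mul_thetaTerm] using baileySum_zero_eq_baileySum_one hq hq0 (thetaTerm p z) n

theorem baileySum_one_thetaTerm_eq_sub (p z : ℂ) (n : ℕ) :
    baileySum q 1 (thetaTerm p z) n =
      baileySum q 0 (thetaTerm p z) (n + 1) -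
        q ^ (n + 1) * baileySum q 0 (thetaTerm p (z / q)) (n + 1) := by
  simpa only [zpow_mul_thetaTerm, ← div_eq_inv_mul] using
    baileySum_one_eq_baileySum_zero hq hq0 (thetaTerm p z) n

theorem baileySum_zero_thetaTerm_eq_mul_sub (hp : p ≠ 0) (hz : z ≠ 0) (n : ℕ) :
    baileySum q 0 (thetaTerm p z) n =
      -z * (baileySum q 1 (thetaTerm p (p * z)) n -
        q ^ n * baileySum q 1 (thetaTerm p (p * z / q)) n) := by
  rw [← baileySum_zero_thetaTerm_div hp, baileySum_zero_thetaTerm_eq_sub hq hq0,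
    show q * (p / z) = p / (z / q) by field_simp, baileySum_one_thetaTerm_div hp hz,
    baileySum_one_thetaTerm_div hp (div_ne_zero hz hq0), ← mul_div_assoc]
  field_simp
  ring

theorem baileySum_one_thetaTerm_eq_mul_sub (hp : p ≠ 0) (hz : z ≠ 0) (n : ℕ) :
    baileySum q 1 (thetaTerm p (p * z)) n =
      -z⁻¹ * (baileySum q 0 (thetaTerm p z) (n + 1) -
        q ^ (n + 1) * baileySum q 0 (thetaTerm p (q * z)) (n + 1)) := by
  rw [← baileySum_zero_thetaTerm_div hp q z, ← baileySum_zero_thetaTerm_div hp q (q * z),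
    mul_comm q z, ← div_div, ← baileySum_one_thetaTerm_eq_sub hq hq0,
    baileySum_one_thetaTerm_div hp hz]
  field_simp

theorem baileySum_zero_eq_baileySum_one_thetaTerm_mul (hz : z ≠ 0) :
    baileySum q 0 (thetaTerm (q * z) z) = baileySum q 1 (thetaTerm (q * z) z) := by
  funext n
  rw [baileySum_zero_thetaTerm_eq_sub hq hq0, baileySum_one_thetaTerm_self (mul_ne_zero hq0 hz),
    mul_zero, sub_zero]

theorem baileyStep_thetaTerm {e : ℕ} (he : e ≤ 1) (p z : ℂ) :
    baileyStep q e (baileySum q e (thetaTerm p z)) =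
      baileySum q e (thetaTerm (p * q ^ 2) (z * q ^ (e + 1))) := by
  simp only [baileyStep_baileySum hq hq0 he, zpow_sq_add_mul_thetaTerm hq0]

theorem baileyChain_one_thetaTerm (p z : ℂ) (k : ℕ) :
    baileyChain q (baileySum q 1 (thetaTerm p z)) k (fun _ => 1) =
      baileySum q 1 (thetaTerm (p * q ^ (2 * k)) (z * q ^ (2 * k))) := by
  induction k with
  | zero => simp [baileyChain]
  | succ k ih => rw [baileyChain, ih, baileyStep_thetaTerm hq hq0 le_rfl]; ring_nf

theorem baileyChain_ite_thetaTerm (hz : z ≠ 0) (k i : ℕ) :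
    baileyChain q (baileySum q 0 (thetaTerm (q * z) z)) (i + k) (fun j => if i ≤ j then 1 else 0) =
      baileySum q 0 (thetaTerm (z * q ^ (2 * (i + k) + 1)) (z * q ^ (i + 2 * k))) := by
  induction i with
  | zero =>
    simp only [Nat.zero_le, if_true, zero_add]
    rw [baileySum_zero_eq_baileySum_one_thetaTerm_mul hq hq0 hz, baileyChain_one_thetaTerm hq hq0,
      show z * q ^ (2 * k + 1) = q * (z * q ^ (2 * k)) by ring,
      baileySum_zero_eq_baileySum_one_thetaTerm_mul hq hq0 (mul_ne_zero hz (pow_ne_zero _ hq0)),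
      mul_assoc]
  | succ i ih =>
    rw [Nat.add_right_comm, baileyChain, if_neg (Nat.not_succ_le_zero i)]
    simp only [Nat.add_le_add_iff_right]
    rw [ih, baileyStep_thetaTerm hq hq0 zero_le_one]
    ring_nf

theorem one_sub_mul_baileySum_zero_thetaTerm (hz : z ≠ 0) (n : ℕ) :
    (1 - q / z * q ^ n) * baileySum q 0 (thetaTerm q z) n =
      (1 - q ^ (2 * n + 1)) * baileySum q 1 (thetaTerm q z) n := by
  have hsub := baileySum_zero_thetaTerm_eq_sub hq hq0 q z n
  have hmul := baileySum_zero_thetaTerm_eq_mul_sub hq hq0 hq0 hz n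
  rw [mul_div_cancel_left₀ z hq0] at hmul
  field_simp
  linear_combination z * hsub - q ^ (n + 1) * hmul

theorem one_sub_mul_baileySum_one_thetaTerm (hz : z ≠ 0) (n : ℕ) :
    (1 - z * q ^ n) * baileySum q 1 (thetaTerm q z) n =
      (1 - q ^ (2 * n + 2)) * baileySum q 0 (thetaTerm q z) (n + 1) := by
  have hsub := baileySum_one_thetaTerm_eq_sub hq hq0 q z n
  have hmul := baileySum_one_thetaTerm_eq_mul_sub hq hq0 hq0 (div_ne_zero hz hq0) n
  rw [mul_div_cancel₀ z hq0] at hmul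
  field_simp at hmul
  linear_combination hsub - q ^ n * hmul

theorem baileySum_zero_thetaTerm_self_base (hz : z ≠ 0) (n : ℕ) :
    baileySum q 0 (thetaTerm q z) n = qPoch z q n * qPoch (q / z) q n / qPoch q q (2 * n) := by
  induction n with
  | zero => simp [baileySum_zero_index, thetaTerm_zero, qPoch_zero]
  | succ n ih =>
    have heven := one_sub_pow_succ_ne_zero hq (2 * n + 1)
    have hodd := one_sub_pow_succ_ne_zero hq (2 * n)
    have hstep := one_sub_mul_baileySum_zero_thetaTerm hq hq0 hz n
    have hstep' := one_sub_mul_baileySum_one_thetaTerm hq hq0 hz n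
    have hden := qPoch_self_ne_zero hq (2 * n)
    rw [eq_div_iff hden] at ih
    rw [qPoch_succ, qPoch_succ, Nat.mul_succ, qPoch_self_succ q (2 * n + 1), qPoch_self_succ,
      eq_div_iff (mul_ne_zero (mul_ne_zero hden hodd) heven)]
    linear_combination (1 - z * q ^ n) * (1 - q / z * q ^ n) * ih -
      qPoch q q (2 * n) * (1 - z * q ^ n) * hstep -
      qPoch q q (2 * n) * (1 - q ^ (2 * n + 1)) * hstep'

end ThetaSums

/-! ### The seeds -/

/-- The `β`-sequence `1 / ((q²; q²)_n (-s; q)_{n+d})` from which the Bailey chain starts. -/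
noncomputable def seedBeta (q s : ℂ) (d n : ℕ) : ℂ :=
  (qPoch (q ^ 2) (q ^ 2) n * qPoch (-s) q (n + d))⁻¹

section Seed

variable {q s : ℂ} (hq : ¬IsOfFinOrder q) (hsq : s ^ 2 = q)

include hq hsq

theorem one_add_mul_pow_ne_zero (n : ℕ) : 1 + s * q ^ n ≠ 0 := by
  intro h
  have hpow : q ^ (2 * n + 1) = 1 := by
    rw [← hsq] at h ⊢
    linear_combination (s * (s ^ 2) ^ n - 1) * h
  exact one_sub_pow_succ_ne_zero hq (2 * n) (sub_eq_zero.mpr hpow.symm)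

theorem qPoch_neg_ne_zero (n : ℕ) : qPoch (-s) q n ≠ 0 := by
  refine prod_ne_zero_iff.mpr fun j _ => ?_
  rw [neg_mul, sub_neg_eq_add]
  exact one_add_mul_pow_ne_zero hq hsq j

variable (hs : s ≠ 0)

include hs

theorem baileySum_zero_thetaTerm_cube (n : ℕ) :
    baileySum q 0 (thetaTerm (s ^ 3) s) n =
      (1 + s * q ^ n) * baileySum q 1 (thetaTerm (s ^ 3) q) n := by
  have hq0 : q ≠ 0 := hsq ▸ pow_ne_zero 2 hs
  have hp : s ^ 3 ≠ 0 := pow_ne_zero 3 hs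
  have hrefl := baileySum_one_thetaTerm_div hp hs q n
  rw [show s ^ 3 / s = q by rw [← hsq]; field_simp] at hrefl
  rw [baileySum_zero_thetaTerm_eq_mul_sub hq hq0 hp hs, show s ^ 3 * s / q = q by
    rw [← hsq]; field_simp]
  linear_combination -hrefl

theorem baileySum_one_thetaTerm_cube (n : ℕ) :
    baileySum q 1 (thetaTerm (s ^ 3) q) n =
      (1 - (q ^ 2) ^ (n + 1)) * baileySum q 0 (thetaTerm (s ^ 3) s) (n + 1) := by
  have hq0 : q ≠ 0 := hsq ▸ pow_ne_zero 2 hs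
  have hp : s ^ 3 ≠ 0 := pow_ne_zero 3 hs
  have hdiv : s ^ 3 / q = s := by rw [← hsq]; field_simp
  have hone : baileySum q 0 (thetaTerm (s ^ 3) 1) (n + 1) =
      q ^ (n + 1) * baileySum q 0 (thetaTerm (s ^ 3) s) (n + 1) := by
    have hcube := baileySum_one_thetaTerm_eq_sub hq hq0 (s ^ 3) (s ^ 3) n
    rw [baileySum_one_thetaTerm_self hp, hdiv] at hcube
    rw [← baileySum_zero_thetaTerm_div hp, div_one]
    linear_combination -hcube
  rw [baileySum_one_thetaTerm_eq_sub hq hq0, div_self hq0, hone,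
    ← baileySum_zero_thetaTerm_div hp, hdiv]
  ring

theorem baileySum_zero_eq_seedBeta : baileySum q 0 (thetaTerm (s ^ 3) s) = seedBeta q s 0 := by
  funext n
  induction n with
  | zero => simp [baileySum_zero_index, thetaTerm_zero, seedBeta, qPoch_zero]
  | succ n ih =>
    have hstep := baileySum_zero_thetaTerm_cube hq hsq hs n
    rw [baileySum_one_thetaTerm_cube hq hsq hs, ih] at hstep
    have hq2 : ¬IsOfFinOrder (q ^ 2) := fun h => hq (h.of_pow two_ne_zero)
    rw [seedBeta, add_zero, ← mul_eq_one_iff_inv_eq₀ (mul_ne_zero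
      (qPoch_self_ne_zero hq2 n) (qPoch_neg_ne_zero hq hsq n))] at hstep
    rw [seedBeta, add_zero, qPoch_self_succ, qPoch_succ]
    refine eq_inv_of_mul_eq_one_left ?_
    linear_combination hstep

theorem baileySum_one_eq_seedBeta : baileySum q 1 (thetaTerm (s ^ 3) q) = seedBeta q s 1 := by
  funext n
  have hstep := baileySum_zero_thetaTerm_cube hq hsq hs n
  rw [baileySum_zero_eq_seedBeta hq hsq hs] at hstep
  refine mul_left_cancel₀ (one_add_mul_pow_ne_zero hq hsq n) (hstep.symm.trans ?_)
  rw [seedBeta, seedBeta, qPoch_succ, add_zero, neg_mul, sub_neg_eq_add]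
  have hn := one_add_mul_pow_ne_zero hq hsq n
  field_simp

end Seed

/-! ### The Jacobi triple product and Euler's identity -/

theorem summable_of_succ_eq_mul {R : Type*} [NormedRing R] [CompleteSpace R] {a u : ℕ → R}
    (hu : Tendsto u atTop (𝓝 0)) (h : ∀ n, a (n + 1) = u n * a n) : Summable a := by
  refine summable_of_ratio_norm_eventually_le one_half_lt_one ?_
  filter_upwards [hu.norm.eventually_le_const (norm_zero.trans_lt one_half_pos)] with n hn
  rw [h]
  exact (norm_mul_le _ _).trans (by gcongr)

theorem tendsto_sum_antidiagonal_mul {𝕜 : Type*} [NormedDivisionRing 𝕜] [CompleteSpace 𝕜]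
    {a b : ℕ → 𝕜} {L : 𝕜} (ha : Tendsto a atTop (𝓝 L))
    (hb : Summable fun i => ‖b i‖) :
    Tendsto (fun n => ∑ p ∈ antidiagonal n, a p.1 * b p.2) atTop (𝓝 (L * ∑' i, b i)) := by
  obtain ⟨C, hC⟩ := (Metric.isBounded_range_of_tendsto a ha).exists_norm_le
  have hC0 : 0 ≤ C := (norm_nonneg (a 0)).trans (hC _ ⟨0, rfl⟩)
  have hsum (n : ℕ) : ∑ p ∈ antidiagonal n, a p.1 * b p.2 =
      ∑' i, if i ≤ n then a (n - i) * b i else 0 := by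
    rw [← Nat.sum_antidiagonal_swap, Nat.sum_antidiagonal_eq_sum_range_succ_mk,
      tsum_eq_sum (s := range (n + 1)) fun i hi => if_neg (by simpa [Nat.lt_succ_iff] using hi)]
    exact sum_congr rfl fun i hi => (if_pos (mem_range_succ_iff.mp hi)).symm
  simp only [hsum, ← tsum_mul_left]
  refine tendsto_tsum_of_dominated_convergence (hb.mul_left C) (fun i => ?_)
    (Eventually.of_forall fun n i => ?_)
  · refine ((ha.comp (tendsto_sub_atTop_nat i)).mul_const (b i)).congr' ?_
    filter_upwards [eventually_ge_atTop i] with n hn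
    rw [if_pos hn, Function.comp_apply]
  · split_ifs
    · rw [norm_mul]
      exact mul_le_mul_of_nonneg_right (hC _ ⟨_, rfl⟩) (norm_nonneg _)
    · rw [norm_zero]
      positivity

theorem tendsto_qPoch (a : ℂ) {q : ℂ} (hq : ‖q‖ < 1) :
    Tendsto (qPoch a q) atTop (𝓝 (qPochInf a q)) :=
  (hasProd_qPochInf a q hq).tendsto_prod_nat

theorem qPochInf_eq_qPoch_mul (a : ℂ) {q : ℂ} (hq : ‖q‖ < 1) (n : ℕ) :
    qPochInf a q = qPoch a q n * qPochInf (a * q ^ n) q := by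
  refine tendsto_nhds_unique ((tendsto_add_atTop_iff_nat n).mpr (tendsto_qPoch a hq)) ?_
  simpa only [add_comm, qPoch_add] using (tendsto_qPoch (a * q ^ n) hq).const_mul (qPoch a q n)

theorem qPochInf_ne_zero {a q : ℂ} (hq : ‖q‖ < 1) (h : ∀ n, qPoch a q n ≠ 0) :
    qPochInf a q ≠ 0 := by
  have hfactor (j : ℕ) : 1 + -(a * q ^ j) ≠ 0 := by
    rw [← sub_eq_add_neg]
    exact right_ne_zero_of_mul (qPoch_succ a q j ▸ h (j + 1))
  have hsum : Summable fun j => ‖-(a * q ^ j)‖ := by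
    simpa only [norm_neg, norm_mul, norm_pow] using
      (summable_geometric_of_lt_one (norm_nonneg q) hq).mul_left ‖a‖
  simpa only [← sub_eq_add_neg, qPochInf] using tprod_one_add_ne_zero_of_summable hfactor hsum

theorem qPochInf_self_ne_zero {q : ℂ} (hq : ‖q‖ < 1) : qPochInf q q ≠ 0 :=
  qPochInf_ne_zero hq (qPoch_self_ne_zero (not_isOfFinOrder_of_norm_lt_one hq))

theorem tendsto_invPoch {q : ℂ} (hq : ‖q‖ < 1) (m : ℤ) :
    Tendsto (fun n : ℕ => invPoch q (n + m)) atTop (𝓝 (qPochInf q q)⁻¹) := by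
  have hshift : Tendsto (fun n : ℕ => ((n : ℤ) + m).toNat) atTop atTop :=
    tendsto_atTop_atTop.mpr fun b => ⟨(b - m).toNat, fun n hn => by lia⟩
  refine (((tendsto_qPoch q hq).inv₀ (qPochInf_self_ne_zero hq)).comp hshift).congr' ?_
  filter_upwards [eventually_ge_atTop (-m).toNat] with n hn
  rw [Function.comp_apply, ← invPoch_natCast, Int.toNat_of_nonneg (by lia)]

theorem exists_norm_invPoch_le {q : ℂ} (hq : ‖q‖ < 1) : ∃ C, ∀ m, ‖invPoch q m‖ ≤ C := by
  obtain ⟨C, hC⟩ := (Metric.isBounded_range_of_tendsto _ (tendsto_invPoch hq 0)).exists_norm_le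
  have hnat (n : ℕ) : ‖invPoch q n‖ ≤ C := hC _ ⟨n, by simp only [add_zero]⟩
  refine ⟨C, fun m => ?_⟩
  rcases lt_or_ge m 0 with hm | hm
  · rw [invPoch_of_neg q hm, norm_zero]
    exact (norm_nonneg _).trans (hnat 0)
  · lift m to ℕ using hm
    exact hnat m

theorem tendsto_baileySum {q : ℂ} (hq : ‖q‖ < 1) (e : ℕ) {c : ℤ → ℂ} (hc : Summable c) :
    Tendsto (baileySum q e c) atTop (𝓝 ((∑' r, c r) / qPochInf q q ^ 2)) := by
  obtain ⟨C, hC⟩ := exists_norm_invPoch_le hq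
  have hC0 : 0 ≤ C := (norm_nonneg _).trans (hC 0)
  rw [div_eq_mul_inv, sq, mul_inv, ← tsum_mul_right]
  refine tendsto_tsum_of_dominated_convergence (bound := fun r => ‖c r‖ * (C * C))
    (hc.norm.mul_right _) (fun r => ?_) (Eventually.of_forall fun n r => ?_)
  · simp only [sub_eq_add_neg, add_assoc]
    exact ((tendsto_invPoch hq (-r)).mul (tendsto_invPoch hq (r + e))).const_mul _
  · rw [norm_mul, norm_mul]
    gcongr
    exacts [hC _, hC _]

section JacobiTripleProduct

variable {p z : ℂ} (hp : ‖p‖ < 1) (hp0 : p ≠ 0) (hz : z ≠ 0)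

include hp hp0 hz

theorem summable_thetaTerm_natCast : Summable fun n : ℕ => thetaTerm p z n := by
  refine summable_of_succ_eq_mul (u := fun n => -z * p ^ n) ?_ fun n => ?_
  · simpa using (tendsto_pow_atTop_nhds_zero_of_norm_lt_one hp).const_mul (-z)
  · rw [Nat.cast_succ, thetaTerm_add_one hp0 hz, ← zpow_mul_thetaTerm, zpow_natCast, mul_assoc]

theorem summable_thetaTerm : Summable (thetaTerm p z) := by
  refine .of_nat_of_neg (summable_thetaTerm_natCast hp hp0 hz) ?_
  simp only [thetaTerm_neg hp0]
  exact summable_thetaTerm_natCast hp hp0 (div_ne_zero hp0 hz)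

theorem tsum_thetaTerm : ∑' r, thetaTerm p z r = qPochInf₃ (p / z) z p p := by
  have hp1 := not_isOfFinOrder_of_norm_lt_one hp
  have hne := qPochInf_self_ne_zero hp
  have hsum := tendsto_baileySum hp 0 (summable_thetaTerm hp hp0 hz)
  have hprod := ((tendsto_qPoch z hp).mul (tendsto_qPoch (p / z) hp)).div
    ((tendsto_qPoch p hp).comp (tendsto_id.const_mul_atTop' two_pos)) hne
  have hlim := tendsto_nhds_unique hsum
    (hprod.congr fun n => (baileySum_zero_thetaTerm_self_base hp1 hp0 hz n).symm)
  rw [qPochInf₃]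
  field_simp at hlim
  linear_combination hlim

theorem tendsto_baileySum_thetaTerm {q : ℂ} (hq : ‖q‖ < 1) (e : ℕ) :
    Tendsto (baileySum q e (thetaTerm p z)) atTop
      (𝓝 (qPochInf₃ (p / z) z p p / qPochInf q q ^ 2)) :=
  tsum_thetaTerm hp hp0 hz ▸ tendsto_baileySum hq e (summable_thetaTerm hp hp0 hz)

end JacobiTripleProduct

/-- The general term `z^m q^{m(m-1)/2} / (q; q)_m` of Euler's expansion of `(-z; q)_∞`. -/
noncomputable def eulerTerm (q z : ℂ) (m : ℕ) : ℂ :=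
  z ^ m * q ^ m.choose 2 / qPoch q q m

theorem eulerTerm_succ (q z : ℂ) (m : ℕ) :
    eulerTerm q z (m + 1) = z * q ^ m / (1 - q ^ (m + 1)) * eulerTerm q z m := by
  rw [eulerTerm, eulerTerm, qPoch_self_succ, Nat.choose_succ_succ', Nat.choose_one_right,
    div_mul_div_comm]
  congr 1 <;> ring

section Euler

variable {q : ℂ} (hq : ‖q‖ < 1) (z : ℂ)

include hq

theorem summable_eulerTerm : Summable (eulerTerm q z) := by
  refine summable_of_succ_eq_mul ?_ (eulerTerm_succ q z)
  have hpow := tendsto_pow_atTop_nhds_zero_of_norm_lt_one hq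
  have hdenom : Tendsto (fun n : ℕ => 1 - q ^ (n + 1)) atTop (𝓝 1) := by
    simpa only [sub_zero] using ((tendsto_add_atTop_iff_nat 1).mpr hpow).const_sub 1
  simpa only [mul_zero, zero_div] using! (hpow.const_mul z).div hdenom one_ne_zero

theorem tsum_eulerTerm_eq_mul :
    ∑' m, eulerTerm q z m = (1 + z) * ∑' m, eulerTerm q (z * q) m := by
  have hdilate (m : ℕ) : eulerTerm q (z * q) m = q ^ m * eulerTerm q z m := by
    rw [eulerTerm, eulerTerm]
    ring
  have hsucc (m : ℕ) :
      eulerTerm q z (m + 1) = eulerTerm q (z * q) (m + 1) + z * eulerTerm q (z * q) m := by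
    have hne := one_sub_pow_succ_ne_zero (not_isOfFinOrder_of_norm_lt_one hq) m
    rw [hdilate, hdilate, eulerTerm_succ]
    field_simp
    ring
  have hsum := summable_eulerTerm hq (z * q)
  rw [(summable_eulerTerm hq z).tsum_eq_zero_add, tsum_congr hsucc,
    ((summable_nat_add_iff 1).mpr hsum).tsum_add (hsum.mul_left z), tsum_mul_left, ← add_assoc,
    add_mul, one_mul, hsum.tsum_eq_zero_add]
  simp only [eulerTerm, pow_zero]

theorem tsum_eulerTerm_eq_qPoch_mul (n : ℕ) :
    ∑' m, eulerTerm q z m = qPoch (-z) q n * ∑' m, eulerTerm q (z * q ^ n) m := by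
  induction n with
  | zero => simp [qPoch_zero]
  | succ n ih => rw [ih, tsum_eulerTerm_eq_mul hq, qPoch_succ, pow_succ]; ring_nf

theorem tendsto_tsum_eulerTerm :
    Tendsto (fun n : ℕ => ∑' m, eulerTerm q (z * q ^ n) m) atTop (𝓝 1) := by
  have hdilate (n m : ℕ) : eulerTerm q (z * q ^ n) m = (q ^ n) ^ m * eulerTerm q z m := by
    rw [eulerTerm, eulerTerm]
    ring
  have hone : ∑' m : ℕ, 0 ^ m * eulerTerm q z m = 1 := by
    rw [tsum_eq_single 0 fun m hm => by rw [zero_pow hm, zero_mul]]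
    simp [eulerTerm, qPoch_zero]
  rw [← hone]
  simp only [hdilate]
  refine tendsto_tsum_of_dominated_convergence (summable_eulerTerm hq z).norm
    (fun m => ((tendsto_pow_atTop_nhds_zero_of_norm_lt_one hq).pow m).mul_const _)
    (Eventually.of_forall fun n m => ?_)
  rw [norm_mul, ← pow_mul, norm_pow]
  exact mul_le_of_le_one_left (norm_nonneg _) (pow_le_one₀ (norm_nonneg q) hq.le)

theorem hasSum_eulerTerm : HasSum (eulerTerm q z) (qPochInf (-z) q) := by
  have hlim := (tendsto_qPoch (-z) hq).mul (tendsto_tsum_eulerTerm hq z)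
  simp only [← tsum_eulerTerm_eq_qPoch_mul hq, mul_one] at hlim
  exact tendsto_nhds_unique hlim tendsto_const_nhds ▸ (summable_eulerTerm hq z).hasSum

end Euler

/-! ### Multiple sums -/

section Tuples

variable {k : ℕ}

theorem nahmEntry_succ (n : Fin k → ℕ) (i : Fin k) : nahmEntry n (i + 1) = n i := by
  simp [nahmEntry]

theorem nahmEntry_cons_one (a : ℕ) (x : Fin k → ℕ) :
    nahmEntry (Fin.cons a x : Fin (k + 1) → ℕ) 1 = a :=
  nahmEntry_succ (Fin.cons a x : Fin (k + 1) → ℕ) 0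

theorem nahmEntry_cons_add_two (a : ℕ) (x : Fin k → ℕ) (j : ℕ) :
    nahmEntry (Fin.cons a x : Fin (k + 1) → ℕ) (j + 2) = nahmEntry x (j + 1) := by
  by_cases hj : j < k
  · exact (nahmEntry_succ _ (Fin.succ ⟨j, hj⟩)).trans (nahmEntry_succ x ⟨j, hj⟩).symm
  · simp [nahmEntry, hj]

@[to_additive sum_Icc_one_eq_sum_range]
theorem prod_Icc_one_eq_prod_range {M : Type*} [CommMonoid M] (f : ℕ → M) (k : ℕ) :
    ∏ j ∈ Icc 1 k, f j = ∏ j ∈ range k, f (j + 1) := by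
  rw [← Ico_add_one_right_eq_Icc, prod_Ico_eq_prod_range, Nat.add_sub_cancel]
  simp only [add_comm]

theorem nahmN_one (n : Fin k → ℕ) : nahmN n 1 = ∑ i, n i := by
  rw [nahmN, sum_Icc_one_eq_sum_range, sum_range]
  simp only [nahmEntry_succ]

theorem nahmN_cons_add_two (a : ℕ) (x : Fin k → ℕ) (j : ℕ) :
    nahmN (Fin.cons a x : Fin (k + 1) → ℕ) (j + 2) = nahmN x (j + 1) := by
  rw [nahmN, nahmN, ← map_add_right_Icc (j + 1) k 1, sum_map]
  refine sum_congr rfl fun l hl => ?_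
  obtain ⟨l, rfl⟩ := Nat.exists_eq_add_of_le' (Nat.one_le_of_lt (mem_Icc.mp hl).1)
  exact nahmEntry_cons_add_two a x l

theorem sum_antidiagonalTuple_succ {M : Type*} [AddCommMonoid M] (N : ℕ)
    (f : (Fin (k + 1) → ℕ) → M) :
    ∑ x ∈ Nat.antidiagonalTuple (k + 1) N, f x =
      ∑ p ∈ antidiagonal N, ∑ x ∈ Nat.antidiagonalTuple k p.2, f (Fin.cons p.1 x) := by
  change (((List.Nat.antidiagonal N).flatMap fun p =>
    (List.Nat.antidiagonalTuple k p.2).map (Fin.cons p.1)).map f).sum =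
      ((List.Nat.antidiagonal N).map fun p =>
        ((List.Nat.antidiagonalTuple k p.2).map fun x => f (Fin.cons p.1 x)).sum).sum
  simp only [List.flatMap, List.map_flatten, List.sum_flatten, List.map_map, Function.comp_def]

/-- The exponent `N_1² + ⋯ + N_k² + e_1 N_1 + ⋯ + e_k N_k`, where `e_j` is encoded as
`e (j - 1)`. -/
def nahmExponent (e : ℕ → ℕ) (n : Fin k → ℕ) : ℕ :=
  ∑ j ∈ range k, (nahmN n (j + 1) ^ 2 + e j * nahmN n (j + 1))

theorem nahmExponent_cons (e : ℕ → ℕ) (a : ℕ) (x : Fin k → ℕ) :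
    nahmExponent e (Fin.cons a x : Fin (k + 1) → ℕ) =
      (a + ∑ i, x i) ^ 2 + e 0 * (a + ∑ i, x i) + nahmExponent (fun j => e (j + 1)) x := by
  have hN : nahmN (Fin.cons a x : Fin (k + 1) → ℕ) 1 = a + ∑ i, x i := by
    rw [nahmN_one, Fin.sum_cons]
  simp only [nahmExponent, sum_range_succ', nahmN_cons_add_two, zero_add, hN]
  exact add_comm _ _

theorem sum_le_nahmExponent (e : ℕ → ℕ) (n : Fin k → ℕ) : ∑ i, n i ≤ nahmExponent e n := by
  cases k with
  | zero => simp
  | succ k =>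
    rw [nahmExponent, sum_range_succ', zero_add, nahmN_one]
    have hsq := Nat.le_self_pow two_ne_zero (∑ i, n i)
    lia

/-- The summand `q^{N_1² + e_1 N_1 + ⋯} b_{n_k} / ((q; q)_{n_1} ⋯ (q; q)_{n_{k-1}})` of the multiple
sum obtained by iterating the Bailey chain from `b`. -/
noncomputable def chainTerm (q : ℂ) (e : ℕ → ℕ) (b : ℕ → ℂ) (n : Fin k → ℕ) : ℂ :=
  q ^ nahmExponent e n * (∏ j ∈ Icc 1 (k - 1), qPoch q q (nahmEntry n j))⁻¹ * b (nahmEntry n k)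

theorem chainTerm_cons (q : ℂ) (e : ℕ → ℕ) (b : ℕ → ℂ) (a : ℕ) (x : Fin (k + 1) → ℕ) :
    chainTerm q e b (Fin.cons a x : Fin (k + 2) → ℕ) =
      q ^ ((a + ∑ i, x i) ^ 2 + e 0 * (a + ∑ i, x i)) * (qPoch q q a)⁻¹ *
        chainTerm q (fun j => e (j + 1)) b x := by
  simp only [chainTerm, nahmExponent_cons, Nat.add_one_sub_one,
    prod_Icc_one_eq_prod_range, prod_range_succ', nahmEntry_cons_add_two, nahmEntry_cons_one,
    zero_add, pow_add, mul_inv]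
  ring

theorem sum_antidiagonalTuple_chainTerm (q : ℂ) (e : ℕ → ℕ) (b : ℕ → ℂ) (N : ℕ) :
    ∑ x ∈ Nat.antidiagonalTuple (k + 1) N, chainTerm q e b x =
      q ^ (N ^ 2 + e 0 * N) * baileyChain q b k (fun j => e (j + 1)) N := by
  induction k generalizing e N with
  | zero => simp [chainTerm, baileyChain, nahmExponent, nahmN_one, nahmEntry]
  | succ k ih =>
    rw [sum_antidiagonalTuple_succ, baileyChain, baileyStep, mul_sum]
    refine sum_congr rfl fun p hp => ?_
    have hterm : ∀ x ∈ Nat.antidiagonalTuple (k + 1) p.2,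
        chainTerm q e b (Fin.cons p.1 x : Fin (k + 2) → ℕ) =
          q ^ (N ^ 2 + e 0 * N) * (qPoch q q p.1)⁻¹ * chainTerm q (fun j => e (j + 1)) b x := by
      intro x hx
      rw [chainTerm_cons, Nat.mem_antidiagonalTuple.mp hx, mem_antidiagonal.mp hp]
    rw [sum_congr rfl hterm, ← mul_sum, ih]
    ring

theorem baileyChain_succ_eq_sum (q : ℂ) (e : ℕ → ℕ) (b : ℕ → ℂ) (M : ℕ) :
    baileyChain q b (k + 1) e M =
      ∑ p ∈ antidiagonal M, (qPoch q q p.1)⁻¹ *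
        ∑ x ∈ Nat.antidiagonalTuple (k + 1) p.2, chainTerm q e b x := by
  simp only [baileyChain, baileyStep, sum_antidiagonalTuple_chainTerm, mul_left_comm, mul_assoc]

theorem hasSum_chainTerm {q : ℂ} (hq : ‖q‖ < 1) {e : ℕ → ℕ} {b : ℕ → ℂ} {L : ℂ}
    (hsum : Summable (chainTerm q e b : (Fin (k + 1) → ℕ) → ℂ))
    (hlim : Tendsto (baileyChain q b (k + 1) e) atTop (𝓝 L)) :
    HasSum (chainTerm q e b : (Fin (k + 1) → ℕ) → ℂ) (qPochInf q q * L) := by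
  have hlevel : HasSum (fun N => ∑ x ∈ Nat.antidiagonalTuple (k + 1) N, chainTerm q e b x)
      (∑' n : Fin (k + 1) → ℕ, chainTerm q e b n) := by
    simpa only [Function.comp_apply, Nat.sigmaAntidiagonalTupleEquivTuple, Equiv.coe_fn_mk,
      sum_coe_sort _ (chainTerm q e b)] using
      ((Nat.sigmaAntidiagonalTupleEquivTuple (k + 1)).hasSum_iff.mpr hsum.hasSum).sigma
        fun N => hasSum_fintype _
  have hne := qPochInf_self_ne_zero hq
  have hconv := tendsto_sum_antidiagonal_mul ((tendsto_qPoch q hq).inv₀ hne) hlevel.summable.norm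
  simp only [← baileyChain_succ_eq_sum, hlevel.tsum_eq] at hconv
  rw [tendsto_nhds_unique hlim hconv, mul_inv_cancel_left₀ hne]
  exact hsum.hasSum

end Tuples

/-- The summand of the multiple sums over `(m, n_1, …, n_k)`, for `s² = q`. The linear part of its
exponent is `d m + e_1 N_1 + ⋯ + e_k N_k`, where `e_j` is encoded as `e (j - 1)`. -/
noncomputable def nahmTerm (q s : ℂ) (d : ℕ) (e : ℕ → ℕ) {k : ℕ} (x : ℕ × (Fin k → ℕ)) : ℂ :=
  s ^ (x.1 ^ 2) * q ^ (x.1 * (nahmEntry x.2 k + d) + nahmExponent e x.2) / nahmDenom q x.1 x.2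

theorem exists_norm_inv_nahmDenom_le {q : ℂ} (hq : ‖q‖ < 1) (k : ℕ) :
    ∃ C, ∀ (m : ℕ) (n : Fin k → ℕ), ‖(nahmDenom q m n)⁻¹‖ ≤ C := by
  have hq2 : ‖q ^ 2‖ < 1 := (norm_pow_lt_one_iff two_ne_zero).mpr hq
  obtain ⟨C, hC⟩ := exists_norm_invPoch_le hq
  obtain ⟨D, hD⟩ := exists_norm_invPoch_le hq2
  have hC0 : 0 ≤ C := (norm_nonneg _).trans (hC 0)
  refine ⟨C * (∏ _j ∈ Icc 1 (k - 1), C) * D, fun m n => ?_⟩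
  rw [nahmDenom, mul_inv, mul_inv, norm_mul, norm_mul, ← prod_inv_distrib, norm_prod]
  gcongr
  exacts [hC m, hC (nahmEntry n _), hD (nahmEntry n k)]

theorem summable_pow_sum {r : ℝ} (hr0 : 0 ≤ r) (hr : r < 1) (k : ℕ) :
    Summable fun n : Fin k → ℕ => r ^ ∑ i, n i := by
  induction k with
  | zero => exact (hasSum_fintype _).summable
  | succ k ih =>
    rw [← (Fin.consEquiv fun _ => ℕ).summable_iff]
    refine ((summable_geometric_of_lt_one hr0 hr).mul_of_nonneg ih
      (fun _ => pow_nonneg hr0 _) fun _ => pow_nonneg hr0 _).congr fun x => ?_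
    simp [Fin.consEquiv, Fin.sum_univ_succ, pow_add]

theorem pow_sq_eq_pow_mul_pow_choose {M : Type*} [Monoid M] (s : M) (m : ℕ) :
    s ^ m ^ 2 = s ^ m * (s ^ 2) ^ m.choose 2 := by
  rw [← pow_mul, ← pow_add]
  congr 1
  induction m with
  | zero => rfl
  | succ m ih =>
    rw [Nat.choose_succ_succ', Nat.choose_one_right]
    linarith

theorem nahmTerm_eq_eulerTerm_mul {q s : ℂ} (hsq : s ^ 2 = q) {k : ℕ} (d : ℕ) (e : ℕ → ℕ) (m : ℕ)
    (n : Fin k → ℕ) :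
    nahmTerm q s d e (m, n) = eulerTerm q (s * q ^ (nahmEntry n k + d)) m *
      chainTerm q e (fun c => (qPoch (q ^ 2) (q ^ 2) c)⁻¹) n := by
  simp only [nahmTerm, eulerTerm, chainTerm, nahmDenom, pow_sq_eq_pow_mul_pow_choose s, hsq,
    div_eq_mul_inv, mul_inv]
  ring

section Nahm

variable {q s : ℂ} (hq : ‖q‖ < 1) (hsq : s ^ 2 = q) {k : ℕ} (d : ℕ) (e : ℕ → ℕ)

include hq hsq

theorem summable_nahmTerm : Summable (nahmTerm q s d e : ℕ × (Fin k → ℕ) → ℂ) := by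
  have hs : ‖s‖ < 1 := (norm_pow_lt_one_iff two_ne_zero).mp (hsq ▸ hq)
  obtain ⟨C, hC⟩ := exists_norm_inv_nahmDenom_le hq k
  refine (((summable_geometric_of_lt_one (norm_nonneg s) hs).mul_of_nonneg
    (summable_pow_sum (norm_nonneg q) hq k) (fun _ => pow_nonneg (norm_nonneg s) _)
    fun _ => pow_nonneg (norm_nonneg q) _).mul_right C).of_norm_bounded fun x => ?_
  rw [nahmTerm, div_eq_mul_inv, norm_mul, norm_mul, norm_pow, norm_pow]
  gcongr ?_ * ?_ * ?_
  · exact pow_le_pow_of_le_one (norm_nonneg s) hs.le (Nat.le_self_pow two_ne_zero _)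
  · exact pow_le_pow_of_le_one (norm_nonneg q) hq.le (le_add_left (sum_le_nahmExponent e x.2))
  · exact hC x.1 x.2

theorem hasSum_nahmTerm_left (n : Fin k → ℕ) :
    HasSum (fun m => nahmTerm q s d e (m, n))
      (qPochInf (-s) q * chainTerm q e (seedBeta q s d) n) := by
  have hne := qPoch_neg_ne_zero (not_isOfFinOrder_of_norm_lt_one hq) hsq (nahmEntry n k + d)
  have hvalue : qPochInf (-(s * q ^ (nahmEntry n k + d))) q *
        chainTerm q e (fun c => (qPoch (q ^ 2) (q ^ 2) c)⁻¹) n =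
      qPochInf (-s) q * chainTerm q e (seedBeta q s d) n := by
    rw [chainTerm, chainTerm, seedBeta, qPochInf_eq_qPoch_mul (-s) hq (nahmEntry n k + d),
      neg_mul, mul_inv (qPoch (q ^ 2) (q ^ 2) _)]
    field_simp
  simp only [nahmTerm_eq_eulerTerm_mul hsq, ← hvalue]
  exact (hasSum_eulerTerm hq _).mul_right _

theorem hasSum_nahmTerm {Θ : ℂ} (hk : 1 ≤ k)
    (hlim : Tendsto (baileyChain q (seedBeta q s d) k e) atTop (𝓝 (Θ / qPochInf q q ^ 2))) :
    HasSum (nahmTerm q s d e : ℕ × (Fin k → ℕ) → ℂ) (qPochInf (-s) q * Θ / qPochInf q q) := by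
  obtain ⟨k, rfl⟩ := Nat.exists_eq_add_of_le' hk
  have hsum := summable_nahmTerm hq hsq d e (k := k + 1)
  have hswap : HasSum (fun x : (Fin (k + 1) → ℕ) × ℕ => nahmTerm q s d e (x.2, x.1))
      (∑' x, nahmTerm q s d e x) := (Equiv.prodComm _ _).hasSum_iff.mpr hsum.hasSum
  have hrows := hswap.prod_fiberwise (hasSum_nahmTerm_left hq hsq d e)
  have hne := qPochInf_ne_zero hq
    (qPoch_neg_ne_zero (not_isOfFinOrder_of_norm_lt_one hq) hsq)
  have hchain := hasSum_chainTerm hq ((summable_mul_left_iff hne).mp hrows.summable) hlim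
  convert hsum.hasSum using 1
  rw [hrows.unique (hchain.mul_left _)]
  field_simp [qPochInf_self_ne_zero hq]

end Nahm

theorem baileyChain_zero_base (d k : ℕ) (e : ℕ → ℕ) :
    baileyChain 0 (seedBeta 0 0 d) k e = fun _ => 1 := by
  induction k generalizing e with
  | zero =>
    funext n
    simp [baileyChain, seedBeta, qPoch_zero_left]
  | succ k ih =>
    funext N
    rw [baileyChain, ih, baileyStep, sum_eq_single_of_mem (N, 0) (by simp)]
    · simp [qPoch_zero_left]
    · rintro ⟨m, n⟩ hp hne
      have hn : n ≠ 0 := by rintro rfl; simp_all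
      simp [hn]

theorem tendsto_baileyChain_zero_base (d k : ℕ) (e : ℕ → ℕ) :
    Tendsto (baileyChain 0 (seedBeta 0 0 d) k e) atTop
      (𝓝 (qPochInf₃ 0 0 0 0 / qPochInf 0 0 ^ 2)) := by
  simp [baileyChain_zero_base, qPochInf₃, qPochInf]

section Limits

variable {q s : ℂ} (hq : ‖q‖ < 1) (hsq : s ^ 2 = q)

include hq hsq

theorem tendsto_baileyChain_ite (i k : ℕ) :
    Tendsto (baileyChain q (seedBeta q s 0) (i + k) fun j => if i ≤ j then 1 else 0) atTop
      (𝓝 (qPochInf₃ (q ^ (i + 1)) (s ^ (1 + 2 * i + 4 * k)) (s ^ (3 + 4 * (i + k)))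
        (s ^ (3 + 4 * (i + k))) / qPochInf q q ^ 2)) := by
  rcases eq_or_ne s 0 with rfl | hs
  · obtain rfl : q = 0 := by simpa using hsq.symm
    simpa [add_assoc] using tendsto_baileyChain_zero_base 0 (i + k) fun j => if i ≤ j then 1 else 0
  · have hq1 := not_isOfFinOrder_of_norm_lt_one hq
    have hq0 : q ≠ 0 := hsq ▸ pow_ne_zero 2 hs
    have hs1 : ‖s‖ < 1 := (norm_pow_lt_one_iff two_ne_zero).mp (hsq ▸ hq)
    have hchain := baileyChain_ite_thetaTerm hq1 hq0 hs k i
    rw [show q * s = s ^ 3 by rw [← hsq]; ring, baileySum_zero_eq_seedBeta hq1 hsq hs] at hchain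
    have hbase : s * q ^ (2 * (i + k) + 1) = s ^ (3 + 4 * (i + k)) := by rw [← hsq]; ring
    have harg : s * q ^ (i + 2 * k) = s ^ (1 + 2 * i + 4 * k) := by rw [← hsq]; ring
    have hquot : s ^ (3 + 4 * (i + k)) / s ^ (1 + 2 * i + 4 * k) = q ^ (i + 1) := by
      rw [div_eq_iff (pow_ne_zero _ hs), ← hsq]
      ring
    rw [hchain, hbase, harg, ← hquot]
    exact tendsto_baileySum_thetaTerm ((norm_pow_lt_one_iff (by lia)).mpr hs1) (pow_ne_zero _ hs)
      (pow_ne_zero _ hs) hq 0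

theorem tendsto_baileyChain_one (k : ℕ) :
    Tendsto (baileyChain q (seedBeta q s 1) k fun _ => 1) atTop
      (𝓝 (qPochInf₃ s (q ^ (1 + 2 * k)) (s ^ (3 + 4 * k)) (s ^ (3 + 4 * k)) /
        qPochInf q q ^ 2)) := by
  rcases eq_or_ne s 0 with rfl | hs
  · obtain rfl : q = 0 := by simpa using hsq.symm
    simpa [add_assoc] using tendsto_baileyChain_zero_base 1 k fun _ => 1
  · have hq1 := not_isOfFinOrder_of_norm_lt_one hq
    have hq0 : q ≠ 0 := hsq ▸ pow_ne_zero 2 hs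
    have hs1 : ‖s‖ < 1 := (norm_pow_lt_one_iff two_ne_zero).mp (hsq ▸ hq)
    have hchain := baileyChain_one_thetaTerm hq1 hq0 (s ^ 3) q k
    have hbase : s ^ 3 * q ^ (2 * k) = s ^ (3 + 4 * k) := by rw [← hsq]; ring
    have harg : q * q ^ (2 * k) = q ^ (1 + 2 * k) := by ring
    have hquot : s ^ (3 + 4 * k) / q ^ (1 + 2 * k) = s := by
      rw [div_eq_iff (pow_ne_zero _ hq0), ← hsq]
      ring
    have hlim := tendsto_baileySum_thetaTerm ((norm_pow_lt_one_iff (by lia)).mpr hs1)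
      (pow_ne_zero (3 + 4 * k) hs) (pow_ne_zero (1 + 2 * k) hq0) hq 1
    rwa [hquot, ← harg, ← hbase, ← hchain, hbase, harg, baileySum_one_eq_seedBeta hq1 hsq hs]
      at hlim

theorem hasSum_nahmTerm_ite {k i : ℕ} (hk : 1 ≤ k) (hik : i ≤ k) :
    HasSum (nahmTerm q s 0 (fun j => if i ≤ j then 1 else 0) : ℕ × (Fin k → ℕ) → ℂ)
      (qPochInf (-s) q * qPochInf₃ (q ^ (i + 1)) (s ^ (3 + 4 * k - 2 * (i + 1)))
        (s ^ (3 + 4 * k)) (s ^ (3 + 4 * k)) / qPochInf q q) := by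
  obtain ⟨k, rfl⟩ := Nat.exists_eq_add_of_le hik
  rw [show 3 + 4 * (i + k) - 2 * (i + 1) = 1 + 2 * i + 4 * k by lia]
  exact hasSum_nahmTerm hq hsq 0 _ hk (tendsto_baileyChain_ite hq hsq i k)

theorem hasSum_nahmTerm_one {k : ℕ} (hk : 1 ≤ k) :
    HasSum (nahmTerm q s 1 (fun _ => 1) : ℕ × (Fin k → ℕ) → ℂ)
      (qPochInf (-s) q * qPochInf₃ s (q ^ (1 + 2 * k)) (s ^ (3 + 4 * k)) (s ^ (3 + 4 * k)) /
        qPochInf q q) :=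
  hasSum_nahmTerm hq hsq 1 _ hk (tendsto_baileyChain_one hq hsq k)

end Limits

theorem nahmExponent_ite {k : ℕ} (i : ℕ) (n : Fin k → ℕ) :
    nahmExponent (fun j => if i ≤ j then 1 else 0) n =
      ∑ j ∈ Icc 1 k, nahmN n j ^ 2 + ∑ j ∈ Icc (i + 1) k, nahmN n j := by
  have hfilter : {j ∈ Icc 1 k | i + 1 ≤ j} = Icc (i + 1) k := by
    ext j
    simp only [mem_filter, mem_Icc]
    lia
  rw [← hfilter, sum_filter, sum_Icc_one_eq_sum_range, sum_Icc_one_eq_sum_range, nahmExponent,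
    sum_add_distrib]
  simp only [ite_mul, one_mul, zero_mul, Nat.add_le_add_iff_right]

theorem nahmExponent_one {k : ℕ} (n : Fin k → ℕ) :
    nahmExponent (fun _ => 1) n = ∑ j ∈ Icc 1 k, nahmN n j ^ 2 + ∑ j ∈ Icc 1 k, nahmN n j := by
  simpa using nahmExponent_ite 0 n

theorem qPochInf_mul_qPochInf_neg (a : ℂ) {q : ℂ} (hq : ‖q‖ < 1) :
    qPochInf a q * qPochInf (-a) q = qPochInf (a ^ 2) (q ^ 2) := by
  have hq2 : ‖q ^ 2‖ < 1 := (norm_pow_lt_one_iff two_ne_zero).mpr hq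
  refine ((hasProd_qPochInf a q hq).mul (hasProd_qPochInf (-a) q hq)).unique ?_
  convert hasProd_qPochInf (a ^ 2) (q ^ 2) hq2 using 2 with j
  ring

theorem qPochInf_sq_mul_qPochInf_mul_sq (a : ℂ) {q : ℂ} (hq : ‖q‖ < 1) :
    qPochInf a (q ^ 2) * qPochInf (a * q) (q ^ 2) = qPochInf a q := by
  have hq2 : ‖q ^ 2‖ < 1 := (norm_pow_lt_one_iff two_ne_zero).mpr hq
  refine (HasProd.even_mul_odd ?_ ?_).unique (hasProd_qPochInf a q hq)
  · simpa only [pow_mul] using hasProd_qPochInf a (q ^ 2) hq2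
  · simpa only [pow_succ', pow_mul, mul_assoc] using hasProd_qPochInf (a * q) (q ^ 2) hq2

theorem qPochInf_neg_div_qPochInf_sq {q : ℂ} (hq : ‖q‖ < 1) :
    qPochInf (-q) (q ^ 2) / qPochInf (q ^ 2) (q ^ 2) =
      (qPochInf q (q ^ 2) * qPochInf (q ^ 4) (q ^ 4))⁻¹ := by
  have hq2 : ‖q ^ 2‖ < 1 := (norm_pow_lt_one_iff two_ne_zero).mpr hq
  have hsign := qPochInf_mul_qPochInf_neg q hq2
  have hparity := qPochInf_sq_mul_qPochInf_mul_sq (q ^ 2) hq2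
  have hne := qPochInf_self_ne_zero hq2
  rw [← sq, ← pow_mul] at hparity
  rw [← pow_mul] at hsign
  norm_num only at hsign hparity
  rw [← hparity, ← hsign] at hne ⊢
  rw [mul_right_comm, div_mul_cancel_right₀ (right_ne_zero_of_mul (left_ne_zero_of_mul hne))]

theorem nahmTerm_fin_two (q : ℂ) (d : ℕ) (e : ℕ → ℕ) (i j k : ℕ) :
    nahmTerm (q ^ 2) q d e (i, ![j, k]) =
      q ^ (i ^ 2 + 2 * (i * (k + d) + ((j + k) ^ 2 + e 0 * (j + k) + (k ^ 2 + e 1 * k)))) /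
        tripleDenom q i j k := by
  have hentry : nahmEntry ![j, k] 1 = j := rfl
  have hentry' : nahmEntry ![j, k] 2 = k := rfl
  have hN : nahmN ![j, k] 1 = j + k := rfl
  have hN' : nahmN ![j, k] 2 = k := rfl
  simp only [nahmTerm, nahmExponent, nahmDenom, tripleDenom, hentry', ← pow_mul, ← pow_add]
  simp [sum_range_succ, hentry, hN, hN']

theorem hasSum_nahmTerm_fin_two {q Θ : ℂ} (hq : ‖q‖ < 1) {d : ℕ} {e : ℕ → ℕ}
    (hsum : HasSum (nahmTerm (q ^ 2) q d e : ℕ × (Fin 2 → ℕ) → ℂ)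
      (qPochInf (-q) (q ^ 2) * Θ / qPochInf (q ^ 2) (q ^ 2))) :
    HasSum (fun x : ℕ × ℕ × ℕ => nahmTerm (q ^ 2) q d e (x.1, ![x.2.1, x.2.2]))
      (Θ / (qPochInf q (q ^ 2) * qPochInf (q ^ 4) (q ^ 4))) := by
  rw [div_eq_mul_inv, ← qPochInf_neg_div_qPochInf_sq hq, mul_div_left_comm, ← mul_div_assoc]
  exact ((Equiv.refl ℕ).prodCongr (finTwoArrowEquiv ℕ).symm).hasSum_iff.mpr hsum

theorem hasSum_nahmTerm_fin_two_ite {q : ℂ} (hq : ‖q‖ < 1) {i : ℕ} (hi : i ≤ 2) :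
    HasSum (fun x : ℕ × ℕ × ℕ =>
        nahmTerm (q ^ 2) q 0 (fun j => if i ≤ j then 1 else 0) (x.1, ![x.2.1, x.2.2]))
      (qPochInf₃ (q ^ (2 * (i + 1))) (q ^ (11 - 2 * (i + 1))) (q ^ 11) (q ^ 11) /
        (qPochInf q (q ^ 2) * qPochInf (q ^ 4) (q ^ 4))) := by
  have hsum := hasSum_nahmTerm_ite ((norm_pow_lt_one_iff two_ne_zero).mpr hq) rfl one_le_two hi
  rw [← pow_mul] at hsum
  exact hasSum_nahmTerm_fin_two hq hsum

theorem hasSum_nahmTerm_fin_two_one {q : ℂ} (hq : ‖q‖ < 1) :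
    HasSum (fun x : ℕ × ℕ × ℕ => nahmTerm (q ^ 2) q 1 (fun _ => 1) (x.1, ![x.2.1, x.2.2]))
      (qPochInf₃ q (q ^ 10) (q ^ 11) (q ^ 11) /
        (qPochInf q (q ^ 2) * qPochInf (q ^ 4) (q ^ 4))) := by
  have hsum := hasSum_nahmTerm_one ((norm_pow_lt_one_iff two_ne_zero).mpr hq) rfl one_le_two
  rw [← pow_mul] at hsum
  exact hasSum_nahmTerm_fin_two hq hsum

theorem qPochInf₃_comm_left (a b c q : ℂ) : qPochInf₃ a b c q = qPochInf₃ b a c q := by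
  simp only [qPochInf₃, mul_comm (qPochInf a q)]

theorem mainTheorem4 :
    -- the four triple sums of index `(1, 1, 2)`
    (∀ q : ℂ, ‖q‖ < 1 →
      HasSum (fun ((i, j, k) : ℕ × ℕ × ℕ) =>
          q ^ (i ^ 2 + 2 * j ^ 2 + 4 * k ^ 2 + 2 * i * k + 4 * j * k) / tripleDenom q i j k)
        (qPochInf₃ (q ^ 5) (q ^ 6) (q ^ 11) (q ^ 11) /
          (qPochInf q (q ^ 2) * qPochInf (q ^ 4) (q ^ 4))) ∧
      HasSum (fun ((i, j, k) : ℕ × ℕ × ℕ) =>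
          q ^ (i ^ 2 + 2 * j ^ 2 + 4 * k ^ 2 + 2 * i * k + 4 * j * k + 2 * k) /
            tripleDenom q i j k)
        (qPochInf₃ (q ^ 4) (q ^ 7) (q ^ 11) (q ^ 11) /
          (qPochInf q (q ^ 2) * qPochInf (q ^ 4) (q ^ 4))) ∧
      HasSum (fun ((i, j, k) : ℕ × ℕ × ℕ) =>
          q ^ (i ^ 2 + 2 * j ^ 2 + 4 * k ^ 2 + 2 * i * k + 4 * j * k + 2 * j + 4 * k) /
            tripleDenom q i j k)
        (qPochInf₃ (q ^ 2) (q ^ 9) (q ^ 11) (q ^ 11) /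
          (qPochInf q (q ^ 2) * qPochInf (q ^ 4) (q ^ 4))) ∧
      HasSum (fun ((i, j, k) : ℕ × ℕ × ℕ) =>
          q ^ (i ^ 2 + 2 * j ^ 2 + 4 * k ^ 2 + 2 * i * k + 4 * j * k + 2 * i + 2 * j + 4 * k) /
            tripleDenom q i j k)
        (qPochInf₃ q (q ^ 10) (q ^ 11) (q ^ 11) /
          (qPochInf q (q ^ 2) * qPochInf (q ^ 4) (q ^ 4)))) ∧
    -- the `(k + 1)`-fold generalization of the first three; `s` is `q ^ (1 / 2)`
    (∀ q s : ℂ, ‖q‖ < 1 → s ^ 2 = q → ∀ k : ℕ, 1 ≤ k → ∀ i : ℕ, 1 ≤ i → i ≤ k + 1 →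
      HasSum (fun ((m, n) : ℕ × (Fin k → ℕ)) =>
          s ^ (m ^ 2) *
            q ^ (m * nahmEntry n k + ∑ j ∈ Finset.Icc 1 k, nahmN n j ^ 2 +
              ∑ j ∈ Finset.Icc i k, nahmN n j) / nahmDenom q m n)
        (qPochInf (-s) q *
          qPochInf₃ (q ^ i) (s ^ (3 + 4 * k - 2 * i)) (s ^ (3 + 4 * k)) (s ^ (3 + 4 * k)) /
          qPochInf q q)) ∧
    -- the `(k + 1)`-fold generalization of the last one; `s` is `q ^ (1 / 2)`
    (∀ q s : ℂ, ‖q‖ < 1 → s ^ 2 = q → ∀ k : ℕ, 1 ≤ k →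
      HasSum (fun ((m, n) : ℕ × (Fin k → ℕ)) =>
          s ^ (m ^ 2) *
            q ^ (m * nahmEntry n k + ∑ j ∈ Finset.Icc 1 k, nahmN n j ^ 2 +
              m + ∑ j ∈ Finset.Icc 1 k, nahmN n j) / nahmDenom q m n)
        (qPochInf (-s) q *
          qPochInf₃ s (q ^ (1 + 2 * k)) (s ^ (3 + 4 * k)) (s ^ (3 + 4 * k)) /
          qPochInf q q)) := by
  refine ⟨fun q hq => ?_, fun q s hq hsq k hk i hi hik => ?_, fun q s hq hsq k hk => ?_⟩
  · refine ⟨?_, ?_, ?_, ?_⟩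
    · rw [qPochInf₃_comm_left]
      convert hasSum_nahmTerm_fin_two_ite hq (i := 2) le_rfl using 2 with ⟨i, j, k⟩
      norm_num [nahmTerm_fin_two]; ring_nf
    · convert hasSum_nahmTerm_fin_two_ite hq (i := 1) one_le_two using 2 with ⟨i, j, k⟩
      norm_num [nahmTerm_fin_two]; ring_nf
    · convert hasSum_nahmTerm_fin_two_ite hq (i := 0) zero_le_two using 2 with ⟨i, j, k⟩
      norm_num [nahmTerm_fin_two]; ring_nf
    · convert hasSum_nahmTerm_fin_two_one hq using 2 with ⟨i, j, k⟩
      rw [nahmTerm_fin_two]; ring_nf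
  · obtain ⟨i, rfl⟩ := Nat.exists_eq_add_of_le' hi
    convert hasSum_nahmTerm_ite hq hsq hk (Nat.le_of_succ_le_succ hik) using 2 with x
    rw [nahmTerm, nahmExponent_ite, add_zero, ← add_assoc]
  · convert hasSum_nahmTerm_one hq hsq hk using 2 with x
    rw [nahmTerm, nahmExponent_one]
    ring_nf
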